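/- Definitions. A finite digraph $I$ is a finite set (also written $I$) with an arbitrary binary relation $E^I\subseteq I\times I$ (loops allowed, symmetry not required); these are the structures over the signature with one binary relation symbol $E$. For $p\ge 1$ let $\mathbf K_p$ be the complete loopless graph on $p$ vertices, with domain $[p]$ and $E^{\mathbf K_p}=\{(i,j)\in[p]^2: i\neq j\}$. A homomorphism $I\to S$ is a map of the domains that sends every pair of $E^I$ to a pair of $E^S$. A partial homomorphism from $I$ to $S$ is a map $h:X\to S$ with $X\subseteq I$ that is a homomorphism to $S$ from the substructure of $I$ induced by $X$. For a positive integer $k$, a $k$-strategy on $I$ and $S$ is a non-empty family $\mathcal H$ of partial homomorphisms from $I$ to $S$ such that (i) $\mathcal H$ is closed under restrictions: $h\in\mathcal H$ and $X\subseteq\operatorname{dom}(h)$ imply $h|_X\in\mathcal H$; and (ii) for every $h\in\mathcal H$ with $|\operatorname{dom}(h)|<k$ and every $x\in I\setminus\operatorname{dom}(h)$ there is $f\in\mathcal H$ that extends $h$ and has $\operatorname{dom}(f)=\operatorname{dom}(h)\cup\{x\}$. Write $I\le_k S$ if a $k$-strategy on $I$ and $S$ exists (equivalently, if the consistency algorithm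 at level $k$ does not refute $I\to S$). For a function $k=k(n)$, the promise problem $\mathrm{PCSP}(S,T)$ (where $S\to T$) is solvable (by the consistency algorithm) in width $k(n)$ if, for every $n$ and every finite instance $I$ with $n$ elements, $I\le_{k(n)}S$ implies that there is a homomorphism $I\to T$. It is solvable in bounded width if it is solvable in width $k(n)$ for some $k(n)=O(1)$, and in sublinear width if it is solvable in width $k(n)$ for some $k(n)=o(n)$. Theorem. For any two integers $p$ and $q$ with $1\le p\le q$, the following statements are equivalent: (a) $\mathrm{PCSP}(\mathbf K_p,\mathbf K_q)$ is solvable by the consistency algorithm in width $3$; (b) $\mathrm{PCSP}(\mathbf K_p,\mathbf K_q)$ is solvable by the consistency algorithm in bounded width; (c) $\mathrm{PCSP}(\mathbf K_p,\mathbf K_q)$ is solvable by the consistency algorithm in sublinear width; (d) $p=1$ or $p=2$. In particular, $\mathrm{PCSP}(\mathbf K_p,\mathbf K_q)$ is not solvable in sublinear width when $3\le p\le q$. -/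

import Mathlib

open scoped FirstOrder

namespace PCSP

open Asymptotics Filter

/-- A map `f : X → S` on a subset `X` of the domain of `I` is a partial homomorphism from `I` to
`S` if it is a homomorphism from the substructure of `I` induced by `X` to `S`. -/
def IsPartialHom (L : FirstOrder.Language.{0, 0}) {I S : Type} [L.Structure I] [L.Structure S]
    (X : Set I) (f : X → S) : Prop :=
  ∀ (r : ℕ) (R : L.Relations r) (a : Fin r → X),
    FirstOrder.Language.Structure.RelMap R (fun i => (a i : I)) →
      FirstOrder.Language.Structure.RelMap R (fun i => f (a i))

/-- `H` is a `k`-strategy on `I` and `S`. The family `H` of partial maps is given by the sets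
`H X` of its members with domain exactly `X`. -/
structure IsStrategy (L : FirstOrder.Language.{0, 0}) {I S : Type} [L.Structure I] [L.Structure S]
    (k : ℕ) (H : (X : Set I) → Set (X → S)) : Prop where
  nonempty : ∃ (X : Set I) (h : X → S), h ∈ H X
  partialHom : ∀ (X : Set I), ∀ h ∈ H X, IsPartialHom L X h
  restrict : ∀ (X : Set I), ∀ h ∈ H X, ∀ (Y : Set I) (hYX : Y ⊆ X),
    (fun y : Y => h (Set.inclusion hYX y)) ∈ H Y
  extend : ∀ (X : Set I), ∀ h ∈ H X, X.ncard < k → ∀ x : I, x ∉ X →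
    ∃ f ∈ H (insert x X), ∀ y : X, f (Set.inclusion (Set.subset_insert x X) y) = h y

/-- `I ≤ₖ S`: there is a `k`-strategy on `I` and `S`. -/
def Consistent (L : FirstOrder.Language.{0, 0}) (k : ℕ) (I S : Type)
    [L.Structure I] [L.Structure S] : Prop :=
  ∃ H : (X : Set I) → Set (X → S), IsStrategy L k H

/-- The promise problem `PCSP(S, T)` over the relational signature `L` is solvable in width `k(n)`:
every finite instance `I` with `n` elements that satisfies `I ≤ S` at level `k(n)` has a
homomorphism to `T`. -/
def SolvableInWidth (L : FirstOrder.Language.{0, 0}) [L.IsRelational] (S T : Type)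
    [L.Structure S] [L.Structure T] (k : ℕ → ℕ) : Prop :=
  ∀ (I : Type) [Finite I] [L.Structure I],
    Consistent L (k (Nat.card I)) I S → Nonempty (I →[L] T)

/-- Solvable in width `k(n)` for some `k(n) = O(1)`. -/
def SolvableInBoundedWidth (L : FirstOrder.Language.{0, 0}) [L.IsRelational] (S T : Type)
    [L.Structure S] [L.Structure T] : Prop :=
  ∃ k : ℕ → ℕ, (fun n => (k n : ℝ)) =O[atTop] (fun _ => (1 : ℝ)) ∧ SolvableInWidth L S T k

/-- Solvable in width `k(n)` for some `k(n) = o(n)`. -/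
def SolvableInSublinearWidth (L : FirstOrder.Language.{0, 0}) [L.IsRelational] (S T : Type)
    [L.Structure S] [L.Structure T] : Prop :=
  ∃ k : ℕ → ℕ, (fun n => (k n : ℝ)) =o[atTop] (fun n => (n : ℝ)) ∧ SolvableInWidth L S T k

/-- The domain of the template `K p`. -/
def K (p : ℕ) : Type := Fin p

/-- The complete loopless graph on `p` vertices as a structure with one binary relation. -/
instance K.instStructure (p : ℕ) : FirstOrder.Language.graph.Structure (K p) :=
  (⊤ : SimpleGraph (Fin p)).structure

end PCSP

/-! For `p ≤ 2`, level 3 suffices: a strategy on `K 2` carries values along a walk while keeping the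
value at its start, so every closed walk is even and the instance is bipartite. For `p ≥ 3`,
counting yields graphs on `n` vertices that are not `q`-colourable, although every set of at most `n
/ C` vertices spans fewer than 5/4 edges per vertex (`exists_isLocallySparse_not_colorable`).
Sparsity gives each set of at most `k` vertices, `k` a small multiple of `n`, a small closure
outside which small sets always have a vertex of degree at most 2. With three colours, proper
colourings therefore extend from closure to closure, and their restrictions form a `k`-strategy
(`consistent_of_isLocallySparse`). So no sublinear width suffices. -/

open Finset

/-! ### Degree-closed sets in locally sparse multigraphs -/

section Multigraph

set_option linter.unusedSectionVars false

variable {ι V : Type} [Fintype ι] [DecidableEq ι] [Fintype V] [DecidableEq V]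

/-- The indices of the edges of the multigraph `f` that have both ends in `A`. -/
def edgesInside (f : ι → V × V) (A : Finset V) : Finset ι :=
  univ.filter fun i => (f i).1 ∈ A ∧ (f i).2 ∈ A

/-- The indices of the edges inside `A` that are incident to `v`. -/
def edgesAt (f : ι → V × V) (A : Finset V) (v : V) : Finset ι :=
  (edgesInside f A).filter fun i => (f i).1 = v ∨ (f i).2 = v

/-- `g` is a proper colouring of the multigraph induced by `f` on `A`; loops are ignored. -/
def IsProperOn {p : ℕ} (f : ι → V × V) (g : V → Fin p) (A : Finset V) : Prop :=
  ∀ i ∈ edgesInside f A, (f i).1 ≠ (f i).2 → g (f i).1 ≠ g (f i).2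

/-- No non-empty set of at most `s` vertices outside `A` has all degrees at least `3`
when it is added to `A`. -/
def IsDegreeClosed (f : ι → V × V) (s : ℕ) (A : Finset V) : Prop :=
  ∀ S : Finset V, Disjoint S A → #S ≤ s → S.Nonempty → ∃ v ∈ S, #(edgesAt f (S ∪ A) v) ≤ 2

/-- Every non-empty set `A` of at most `s` vertices spans fewer than `5 / 4 * #A` edges. -/
def IsLocallySparse (f : ι → V × V) (s : ℕ) : Prop :=
  ∀ A : Finset V, A.Nonempty → #A ≤ s → 4 * #(edgesInside f A) < 5 * #A

/-- The simple graph underlying the multigraph `f`. -/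
def underlyingGraph (f : ι → V × V) : SimpleGraph V :=
  SimpleGraph.fromRel fun x y => ∃ i, f i = (x, y)

variable {f : ι → V × V} {s : ℕ} {A B : Finset V}

theorem mem_edgesInside {i : ι} : i ∈ edgesInside f A ↔ (f i).1 ∈ A ∧ (f i).2 ∈ A := by
  simp [edgesInside]

theorem edgesInside_mono (h : A ⊆ B) : edgesInside f A ⊆ edgesInside f B := fun i hi => by
  rw [mem_edgesInside] at *
  exact ⟨h hi.1, h hi.2⟩

theorem IsProperOn.mono {p : ℕ} {g : V → Fin p} (hg : IsProperOn f g B) (h : A ⊆ B) :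
    IsProperOn f g A := fun i hi => hg i (edgesInside_mono h hi)

/-- Some vertex of `B \ A` has degree at most 2 inside `B`: colour the rest of `B` by induction, and
a third colour remains for that vertex. -/
theorem IsDegreeClosed.exists_extension {p : ℕ} (hp : 3 ≤ p) (hA : IsDegreeClosed f s A)
    {g : V → Fin p} (hg : IsProperOn f g A) (hAB : A ⊆ B) (hB : #B ≤ s) :
    ∃ g' : V → Fin p, (∀ x ∈ A, g' x = g x) ∧ IsProperOn f g' B := by
  induction B using Finset.strongInduction with
  | H B ih =>
    by_cases hne : B = A
    · exact ⟨g, fun _ _ => rfl, hne ▸ hg⟩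
    have hS : (B \ A).Nonempty := by
      rw [sdiff_nonempty]
      exact fun h => hne (h.antisymm hAB)
    obtain ⟨v, hv, hdeg⟩ := hA (B \ A) sdiff_disjoint
      ((card_le_card sdiff_subset).trans hB) hS
    rw [sdiff_union_of_subset hAB] at hdeg
    rw [mem_sdiff] at hv
    obtain ⟨g', hg'A, hg'⟩ := ih (B.erase v) (erase_ssubset hv.1)
      (fun x hx => mem_erase.2 ⟨fun h => hv.2 (h ▸ hx), hAB hx⟩)
      ((card_le_card (erase_subset _ _)).trans hB)
    obtain ⟨c, -, hc⟩ := exists_mem_notMem_of_card_lt_card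
      (s := (edgesAt f B v).image fun i => if (f i).1 = v then g' (f i).2 else g' (f i).1)
      (t := (univ : Finset (Fin p))) (by
        rw [card_univ, Fintype.card_fin]
        exact (card_image_le.trans hdeg).trans_lt hp)
    refine ⟨Function.update g' v c, fun x hx => ?_, fun i hi hne => ?_⟩
    · rw [Function.update_of_ne (ne_of_mem_of_not_mem hx hv.2), hg'A x hx]
    · rw [mem_edgesInside] at hi
      simp only [mem_image, not_exists, not_and, edgesAt, mem_filter, mem_edgesInside] at hc
      by_cases h1 : (f i).1 = v
      · have := hc i ⟨hi, .inl h1⟩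
        rw [if_pos h1] at this
        rw [h1, Function.update_self, Function.update_of_ne (fun h => hne (h1.trans h.symm))]
        exact fun h => this h.symm
      by_cases h2 : (f i).2 = v
      · have := hc i ⟨hi, .inr h2⟩
        rw [if_neg h1] at this
        rwa [h2, Function.update_self, Function.update_of_ne h1]
      · rw [Function.update_of_ne h1, Function.update_of_ne h2]
        exact hg' i (mem_edgesInside.2 ⟨mem_erase.2 ⟨h1, hi.1⟩, mem_erase.2 ⟨h2, hi.2⟩⟩) hne

theorem edgesAt_mono (h : A ⊆ B) (v : V) : edgesAt f A v ⊆ edgesAt f B v :=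
  filter_subset_filter _ (edgesInside_mono h)

/-- If `S` violates closedness of `A ∩ B`, then its part outside `A` would violate closedness of
`A`, since degrees only grow with the set; likewise for `B`. Hence `S ⊆ A ∩ B`, a contradiction. -/
theorem IsDegreeClosed.inter (hA : IsDegreeClosed f s A) (hB : IsDegreeClosed f s B) :
    IsDegreeClosed f s (A ∩ B) := by
  intro S hS hcard hne
  by_contra! hdeg
  have key : ∀ C : Finset V, IsDegreeClosed f s C → A ∩ B ⊆ C → S ⊆ C := by
    intro C hC hsub
    by_contra hSC
    obtain ⟨v, hv, hv2⟩ := hC (S \ C) sdiff_disjoint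
      ((card_le_card sdiff_subset).trans hcard) (sdiff_nonempty.2 hSC)
    refine absurd (hdeg v (mem_sdiff.1 hv).1) (not_lt.2 (le_trans (card_le_card ?_) hv2))
    refine edgesAt_mono ?_ v
    rw [sdiff_union_self_eq_union]
    exact union_subset_union_right hsub
  obtain ⟨x, hx⟩ := hne
  exact disjoint_left.1 hS hx
    (mem_inter.2 ⟨key A hA inter_subset_left hx, key B hB inter_subset_right hx⟩)

theorem isDegreeClosed_univ : IsDegreeClosed f s univ := by
  rintro S hS - ⟨x, hx⟩
  exact absurd (mem_univ x) (disjoint_left.1 hS hx)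

theorem exists_least_isDegreeClosed (f : ι → V × V) (s : ℕ) (X : Set V) :
    ∃ A : Finset V, X ⊆ A ∧ IsDegreeClosed f s A ∧
      ∀ B : Finset V, X ⊆ B → IsDegreeClosed f s B → A ⊆ B := by
  classical
  obtain ⟨A, hA, hmin⟩ := exists_min_image
    (univ.filter fun A : Finset V => X ⊆ A ∧ IsDegreeClosed f s A) card
    ⟨univ, by simp [isDegreeClosed_univ]⟩
  simp only [mem_filter, mem_univ, true_and] at hA hmin
  refine ⟨A, hA.1, hA.2, fun B hXB hB => ?_⟩
  have h := hmin (A ∩ B) ⟨by rw [coe_inter]; exact Set.subset_inter hA.1 hXB, hA.2.inter hB⟩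
  exact inter_eq_left.1 (eq_of_subset_of_card_le inter_subset_left h)

/-- Double counting: a new edge has at most two ends in `S`. -/
theorem card_edgesInside_union {S : Finset V} (hS : Disjoint S A)
    (h : ∀ v ∈ S, 3 ≤ #(edgesAt f (S ∪ A) v)) :
    3 * #S + 2 * #(edgesInside f A) ≤ 2 * #(edgesInside f (S ∪ A)) := by
  set D := edgesInside f (S ∪ A) \ edgesInside f A with hD
  have hsub := edgesInside_mono (f := f) (A := A) (B := S ∪ A) subset_union_right
  have hcard : #D + #(edgesInside f A) = #(edgesInside f (S ∪ A)) :=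
    card_sdiff_add_card_eq_card hsub
  have h1 : #S * 3 ≤ #D * 2 := by
    refine card_mul_le_card_mul (fun v i => (f i).1 = v ∨ (f i).2 = v) (fun v hv => ?_)
      (fun i hi => ?_)
    · refine (h v hv).trans (card_le_card fun i hi => ?_)
      rw [edgesAt, mem_filter] at hi
      rw [mem_bipartiteAbove, hD, mem_sdiff, mem_edgesInside (A := A)]
      refine ⟨⟨hi.1, fun hA => disjoint_left.1 hS hv ?_⟩, hi.2⟩
      rcases hi.2 with e | e
      · exact e ▸ hA.1
      · exact e ▸ hA.2
    · refine (card_le_card (t := {(f i).1, (f i).2}) fun v hv => ?_).trans card_le_two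
      rw [mem_bipartiteBelow] at hv
      simp only [mem_insert, mem_singleton]
      exact hv.2.imp Eq.symm Eq.symm
  lia

theorem IsLocallySparse.isDegreeClosed_empty (hf : IsLocallySparse f s) :
    IsDegreeClosed f s ∅ := by
  intro S hS hcard hne
  by_contra! h
  have h1 := card_edgesInside_union hS h
  have h2 := hf (S ∪ ∅) (by simpa using hne) (by simpa using hcard)
  rw [union_empty] at h1 h2
  lia

/-- Take a largest `A` with `3 * #A ≤ 2 * #(edgesInside f A) + 3 * k`. Adding a violating `S`
preserves this inequality, and sparsity then forces size below `6 * k ≤ s`, contradicting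
maximality. Sparsity is needed up to `2 * s` because a priori `S ∪ A` can be that large. -/
theorem IsLocallySparse.exists_isDegreeClosed (hf : IsLocallySparse f (2 * s)) {k : ℕ}
    (hk : 6 * k ≤ s) {X : Finset V} (hX : #X ≤ k) :
    ∃ A : Finset V, X ⊆ A ∧ IsDegreeClosed f s A ∧ #A ≤ s := by
  classical
  obtain ⟨A, hA, hmax⟩ := exists_max_image
    (univ.filter fun A : Finset V =>
      X ⊆ A ∧ #A ≤ s ∧ 3 * #A ≤ 2 * #(edgesInside f A) + 3 * k) card
    ⟨X, by simp; lia⟩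
  simp only [mem_filter, mem_univ, true_and] at hA hmax
  refine ⟨A, hA.1, fun S hS hcard hne => ?_, hA.2.1⟩
  by_contra! h
  have h1 := card_edgesInside_union hS h
  have h2 := card_union_of_disjoint hS
  have h3 := hne.card_pos
  have h4 := hf (S ∪ A) (hne.mono subset_union_left) (by lia)
  have h5 := hmax (S ∪ A) ⟨hA.1.trans subset_union_right, by lia, by lia⟩
  lia

end Multigraph

/-! ### Strategies from colourings of closures -/

namespace PCSP

open FirstOrder

theorem IsPartialHom.graph_iff {I S : Type} [Language.graph.Structure I]
    [Language.graph.Structure S] {X : Set I} {h : X → S} :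
    IsPartialHom Language.graph X h ↔ ∀ x y : X,
      Language.Structure.RelMap Language.adj ![(x : I), y] →
        Language.Structure.RelMap Language.adj ![h x, h y] := by
  constructor
  · intro H x y hxy
    have := H 2 Language.adj ![x, y]
    convert this ?_ using 2
    · rename_i i; fin_cases i <;> rfl
    · convert hxy using 2
      rename_i i; fin_cases i <;> rfl
  · rintro H r R a hR
    cases R
    have := H (a 0) (a 1)
    convert this ?_ using 2
    · rename_i i; fin_cases i <;> rfl
    · convert hR using 2
      rename_i i; fin_cases i <;> rfl

theorem K.relMap_adj {p : ℕ} {a b : K p} :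
    Language.Structure.RelMap Language.adj ![a, b] ↔ a ≠ b :=
  Iff.rfl

theorem consistent_of_isLocallySparse {ι V : Type} [Fintype ι] [DecidableEq ι] [Fintype V]
    [DecidableEq V] {f : ι → V × V} {s k p : ℕ} (hf : IsLocallySparse f (2 * s))
    (hk : 6 * k ≤ s) (hp : 3 ≤ p) :
    letI := (underlyingGraph f).structure
    Consistent Language.graph k V (K p) := by
  let := (underlyingGraph f).structure
  choose cl hsub hcl hmin using exists_least_isDegreeClosed f s
  have hmono : ∀ X Y : Set V, X ⊆ Y → cl X ⊆ cl Y := fun X Y h =>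
    hmin X (cl Y) (h.trans (hsub Y)) (hcl Y)
  have hcard : ∀ X : Set V, X.ncard ≤ k → #(cl X) ≤ s := by
    intro X hX
    classical
    rw [Set.ncard_eq_toFinset_card'] at hX
    obtain ⟨A, hXA, hA, hAs⟩ := hf.exists_isDegreeClosed hk hX
    exact (card_le_card (hmin X A (by simpa using (coe_subset.2 hXA)) hA)).trans hAs
  have hempty : IsDegreeClosed f s ∅ :=
    IsLocallySparse.isDegreeClosed_empty fun A hA h => hf A hA (by lia)
  -- Members are restrictions of proper colourings of the closure of their domain, not merely of the
  -- domain; this is what makes them extendable.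
  refine ⟨fun X => {h | X.ncard ≤ k ∧ ∃ g : V → Fin p,
    IsProperOn f g (cl X) ∧ ∀ x : X, h x = g x}, ?_, ?_, ?_, ?_⟩
  · obtain ⟨g, -, hg⟩ := hempty.exists_extension (p := p) hp (g := fun _ => ⟨0, by lia⟩)
      (fun i hi => by simp [mem_edgesInside] at hi) (empty_subset (cl ∅)) (hcard ∅ (by simp))
    exact ⟨∅, fun x => g x, by simp, g, hg, fun _ => rfl⟩
  · rintro X h ⟨-, g, hg, hhg⟩
    rw [IsPartialHom.graph_iff]
    intro x y hxy
    rw [K.relMap_adj, hhg, hhg]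
    obtain ⟨hne, ⟨i, hi⟩ | ⟨i, hi⟩⟩ := hxy
    · have := hg i (mem_edgesInside.2 (by rw [hi]; exact ⟨hsub X x.2, hsub X y.2⟩))
      rw [hi] at this
      exact this hne
    · have := hg i (mem_edgesInside.2 (by rw [hi]; exact ⟨hsub X y.2, hsub X x.2⟩))
      rw [hi] at this
      exact (this hne.symm).symm
  · rintro X h ⟨hX, g, hg, hhg⟩ Y hYX
    exact ⟨(Set.ncard_le_ncard hYX).trans hX, g, hg.mono (hmono _ _ hYX), fun y => hhg _⟩
  · rintro X h ⟨-, g, hg, hhg⟩ hX x hx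
    have hX' : (insert x X).ncard ≤ k := (Set.ncard_insert_le x X).trans hX
    obtain ⟨g', hgg', hg'⟩ := (hcl X).exists_extension hp hg
      (hmono X (insert x X) (Set.subset_insert x X)) (hcard _ hX')
    exact ⟨fun y => g' y, ⟨hX', g', hg', fun _ => rfl⟩,
      fun y => (hgg' y (hsub X y.2)).trans (hhg y).symm⟩

end PCSP

/-! ### Width 3 for one and two colours -/

namespace PCSP

open FirstOrder

section Strategy

variable {I S : Type} {H : (X : Set I) → Set (X → S)} {k : ℕ}

/-- Some member of `H` whose domain has at most two elements maps `x` to `a` and `y` to `b`. -/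
def PairValue (H : (X : Set I) → Set (X → S)) (x y : I) (a b : S) : Prop :=
  ∃ (X : Set I) (h : X → S) (hx : x ∈ X) (hy : y ∈ X),
    h ∈ H X ∧ X.ncard ≤ 2 ∧ h ⟨x, hx⟩ = a ∧ h ⟨y, hy⟩ = b

theorem PairValue.eq {x : I} {a b : S} (h : PairValue H x x a b) : a = b := by
  obtain ⟨X, h, hx, hy, hh, hX, rfl, rfl⟩ := h
  rfl

variable [Language.graph.Structure I] [Language.graph.Structure S]

theorem IsStrategy.exists_extension (hH : IsStrategy Language.graph k H) {X : Set I} {h : X → S}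
    (hh : h ∈ H X) (hX : X.ncard < k) (z : I) :
    ∃ (Y : Set I) (hXY : X ⊆ Y) (_ : z ∈ Y) (f : Y → S), f ∈ H Y ∧
      ∀ x : X, f (Set.inclusion hXY x) = h x := by
  by_cases hz : z ∈ X
  · exact ⟨X, subset_rfl, hz, h, hh, fun x => rfl⟩
  · obtain ⟨f, hf, hfh⟩ := hH.extend X h hh hX z hz
    exact ⟨insert z X, Set.subset_insert z X, Set.mem_insert z X, f, hf, hfh⟩

theorem IsStrategy.pairValue_of_mem (hH : IsStrategy Language.graph k H) {X : Set I} {h : X → S}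
    (hh : h ∈ H X) {x y : I} (hx : x ∈ X) (hy : y ∈ X) :
    PairValue H x y (h ⟨x, hx⟩) (h ⟨y, hy⟩) :=
  ⟨{x, y}, _, by simp, by simp,
    hH.restrict X h hh {x, y} (Set.insert_subset hx (Set.singleton_subset_iff.2 hy)),
    (Set.ncard_insert_le x {y}).trans (by simp), rfl, rfl⟩

theorem IsStrategy.exists_pairValue_self (hH : IsStrategy Language.graph k H) (hk : 0 < k)
    (x : I) : ∃ a, PairValue H x x a a := by
  obtain ⟨X, h, hh⟩ := hH.nonempty
  obtain ⟨Y, -, hx, f, hf, -⟩ := hH.exists_extension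
    (hH.restrict X h hh ∅ (Set.empty_subset X)) (by simpa using hk) x
  exact ⟨_, hH.pairValue_of_mem hf hx hx⟩

/-- Path consistency: level 3 leaves room for `z` beside `x` and `y`, and the triple restricts to
its pairs. -/
theorem IsStrategy.exists_pairValue (hH : IsStrategy Language.graph k H) (hk : 3 ≤ k)
    {x y : I} {a b : S} (h : PairValue H x y a b) (z : I) :
    ∃ c, PairValue H x z a c ∧ PairValue H y z b c := by
  obtain ⟨X, h, hx, hy, hh, hX, rfl, rfl⟩ := h
  obtain ⟨Y, hXY, hz, f, hf, hfh⟩ := hH.exists_extension hh (by lia) z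
  refine ⟨f ⟨z, hz⟩, ?_, ?_⟩
  · rw [← hfh]
    exact hH.pairValue_of_mem hf _ hz
  · rw [← hfh]
    exact hH.pairValue_of_mem hf _ hz

theorem IsStrategy.relMap (hH : IsStrategy Language.graph k H)
    {x y : I} {a b : S} (h : PairValue H x y a b)
    (hxy : Language.Structure.RelMap Language.adj ![x, y]) :
    Language.Structure.RelMap Language.adj ![a, b] := by
  obtain ⟨X, h, hx, hy, hh, hX, rfl, rfl⟩ := h
  exact IsPartialHom.graph_iff.1 (hH.partialHom X h hh) ⟨x, hx⟩ ⟨y, hy⟩ hxy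

theorem IsStrategy.relMap_swap (hH : IsStrategy Language.graph k H)
    {x y : I} {a b : S} (h : PairValue H x y a b)
    (hxy : Language.Structure.RelMap Language.adj ![y, x]) :
    Language.Structure.RelMap Language.adj ![b, a] := by
  obtain ⟨X, h, hx, hy, hh, hX, rfl, rfl⟩ := h
  exact IsPartialHom.graph_iff.1 (hH.partialHom X h hh) ⟨y, hy⟩ ⟨x, hx⟩ hxy

theorem nonempty_hom_iff : Nonempty (I →[Language.graph] S) ↔
    ∃ g : I → S, ∀ x y, Language.Structure.RelMap Language.adj ![x, y] →
      Language.Structure.RelMap Language.adj ![g x, g y] := by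
  constructor
  · rintro ⟨g⟩
    refine ⟨g, fun x y h => ?_⟩
    have := g.map_rel' Language.adj ![x, y] h
    convert this using 2
    funext i; fin_cases i <;> rfl
  · rintro ⟨g, hg⟩
    refine ⟨⟨g, fun f => isEmptyElim f, fun R a hR => ?_⟩⟩
    cases R
    have := hg (a 0) (a 1)
    convert this ?_ using 2
    · funext i; fin_cases i <;> rfl
    · convert hR using 2
      funext i; fin_cases i <;> rfl

end Strategy

theorem solvableInWidth_one {q : ℕ} (hq : 1 ≤ q) :
    SolvableInWidth Language.graph (K 1) (K q) fun _ => 3 := by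
  rintro I _ _ ⟨H, hH⟩
  rw [nonempty_hom_iff]
  refine ⟨fun _ => (⟨0, hq⟩ : Fin q), fun x y hxy => ?_⟩
  obtain ⟨a, ha⟩ := hH.exists_pairValue_self (by simp) x
  obtain ⟨c, hc, -⟩ := hH.exists_pairValue le_rfl ha y
  exact absurd (Subsingleton.elim (α := Fin 1) a c) (K.relMap_adj.1 (hH.relMap hc hxy))

/-- With only two values, each edge flips the value at the moving end while the value at `x` stays
fixed. -/
theorem IsStrategy.exists_pairValue_walk {I : Type} [Language.graph.Structure I]
    {H : (X : Set I) → Set (X → K 2)} {k : ℕ} (hH : IsStrategy Language.graph k H) (hk : 3 ≤ k)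
    {x u v : I}
    (w : (SimpleGraph.fromRel fun x y : I =>
      Language.Structure.RelMap Language.adj ![x, y]).Walk u v) :
    ∀ {a b : K 2}, PairValue H x u a b → ∃ c, PairValue H x v a c ∧ (c = b ↔ Even w.length) := by
  induction w with
  | nil => exact fun h => ⟨_, h, by simp⟩
  | cons hadj w ih =>
    intro a b h
    obtain ⟨c, hc, hbc⟩ := hH.exists_pairValue hk h _
    have hne : b ≠ c := by
      rcases hadj.2 with h | h
      · exact K.relMap_adj.1 (hH.relMap hbc h)
      · exact (K.relMap_adj.1 (hH.relMap_swap hbc h)).symm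
    obtain ⟨d, hd, hdc⟩ := ih hc
    refine ⟨d, hd, ?_⟩
    rw [SimpleGraph.Walk.length_cons, Nat.even_add_one, ← hdc]
    have key : ∀ b c d : Fin 2, b ≠ c → (d = b ↔ ¬ d = c) := by decide
    exact key b c d hne

theorem solvableInWidth_two {q : ℕ} (hq : 2 ≤ q) :
    SolvableInWidth Language.graph (K 2) (K q) fun _ => 3 := by
  rintro I _ _ ⟨H, hH⟩
  rw [nonempty_hom_iff]
  obtain ⟨g⟩ : (SimpleGraph.fromRel fun x y : I =>
      Language.Structure.RelMap Language.adj ![x, y]).Colorable 2 := by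
    rw [SimpleGraph.two_colorable_iff_forall_loop_even]
    intro u w
    obtain ⟨a, ha⟩ := hH.exists_pairValue_self (by simp) u
    obtain ⟨c, hc, hca⟩ := hH.exists_pairValue_walk le_rfl w ha
    exact hca.1 hc.eq.symm
  refine ⟨fun x => Fin.castLE hq (g x), fun x y hxy => ?_⟩
  -- The simple graph forgets loops of `I`, so these are excluded separately.
  have hne : x ≠ y := by
    rintro rfl
    obtain ⟨a, ha⟩ := hH.exists_pairValue_self (by simp) x
    exact K.relMap_adj.1 (hH.relMap ha hxy) rfl
  exact fun h => g.valid ⟨hne, .inl hxy⟩ (Fin.castLE_injective hq h)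

end PCSP

/-! ### Counting sparse multigraphs of large chromatic number -/

theorem card_filter_forall_mem {ι E : Type} [Fintype ι] [DecidableEq ι] [Fintype E]
    [DecidableEq E] (T : Finset ι) (B : Finset E)
    [DecidablePred fun f : ι → E => ∀ i ∈ T, f i ∈ B] :
    #{f : ι → E | ∀ i ∈ T, f i ∈ B} = #B ^ #T * Fintype.card E ^ (Fintype.card ι - #T) := by
  have : ({f : ι → E | ∀ i ∈ T, f i ∈ B} : Finset (ι → E)) =
      Fintype.piFinset fun i => if i ∈ T then B else univ := by
    ext f
    simp only [mem_filter, mem_univ, true_and, Fintype.mem_piFinset]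
    refine forall_congr' fun i => ?_
    split_ifs with h <;> simp [h]
  rw [this, Fintype.card_piFinset, ← prod_mul_prod_compl T]
  congr 1
  · rw [prod_congr rfl (g := fun _ => #B) fun i hi => by rw [if_pos hi], prod_const]
  · rw [prod_congr rfl (g := fun _ => Fintype.card E) fun i hi => by
      rw [if_neg (mem_compl.1 hi), card_univ], prod_const, card_compl]

theorem choose_le_three_mul_div_pow (n : ℕ) {m : ℕ} (hm : 1 ≤ m) :
    (n.choose m : ℝ) ≤ (3 * n / m) ^ m := by
  have hm' : (0 : ℝ) < m := by exact_mod_cast hm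
  have h1 : (m : ℝ) ^ m / m.factorial ≤ 3 ^ m := by
    refine (Real.pow_div_factorial_le_exp (m : ℝ) hm'.le m).trans ?_
    rw [← mul_one (m : ℝ), Real.exp_nat_mul]
    exact pow_le_pow_left₀ (Real.exp_pos 1).le Real.exp_one_lt_three.le m
  calc (n.choose m : ℝ) ≤ (n : ℝ) ^ m / m.factorial := Nat.choose_le_pow_div m n
    _ = (n / m : ℝ) ^ m * ((m : ℝ) ^ m / m.factorial) := by
      rw [div_pow]; field_simp
    _ ≤ (n / m : ℝ) ^ m * 3 ^ m := by gcongr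
    _ = (3 * n / m) ^ m := by rw [← mul_pow]; ring

/-- With `x = m / n` and `r = ⌈m / 4⌉`, the powers of `x` cancel to `x ^ r`. As `m ≤ 4 * r`, the
other factors are at most `(3 ^ 9 * D ^ 5) ^ r`, and `1 / 256 = (1 / 4) ^ 4` pays for the final
bound. -/
theorem choose_mul_choose_mul_pow_le {n D m : ℕ} (hm : 1 ≤ m) (hD : 1 ≤ D)
    (hmn : 256 * 3 ^ 9 * D ^ 5 * m ≤ n) :
    (n.choose m : ℝ) * ((D * n).choose (m + (m + 3) / 4)) * ((m : ℝ) ^ 2) ^ (m + (m + 3) / 4) ≤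
      (1 / 4) ^ m * ((n : ℝ) ^ 2) ^ (m + (m + 3) / 4) := by
  obtain ⟨r, hr⟩ : ∃ r, r = (m + 3) / 4 := ⟨_, rfl⟩
  rw [← hr]
  have hm' : (0 : ℝ) < m := by exact_mod_cast hm
  have hD' : (1 : ℝ) ≤ D := by exact_mod_cast hD
  have hn : 0 < n := lt_of_lt_of_le (by positivity) hmn
  have hn' : (0 : ℝ) < n := by exact_mod_cast hn
  obtain ⟨x, hx⟩ : ∃ x : ℝ, x = m / n := ⟨_, rfl⟩
  have hx0 : 0 < x := hx ▸ div_pos hm' hn'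
  have hmx : (m : ℝ) = x * n := by rw [hx]; field_simp
  have hsmall : 3 ^ 9 * (D : ℝ) ^ 5 * x ≤ 1 / 256 := by
    rw [hx, mul_div_assoc', div_le_iff₀ hn']
    have : (256 * 3 ^ 9 * D ^ 5 * m : ℝ) ≤ n := by exact_mod_cast hmn
    linarith
  have h1 : (n.choose m : ℝ) ≤ (3 / x) ^ m := by
    refine (choose_le_three_mul_div_pow n hm).trans (le_of_eq ?_)
    rw [hmx]; field_simp
  have h2 : ((D * n).choose (m + r) : ℝ) ≤ (3 * D / x) ^ (m + r) := by
    refine (choose_le_three_mul_div_pow (D * n) (by lia)).trans ?_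
    refine pow_le_pow_left₀ (by positivity) ?_ _
    have : (m : ℝ) ≤ (m + r : ℕ) := by exact_mod_cast Nat.le_add_right m r
    calc (3 * ((D * n : ℕ) : ℝ) / (m + r : ℕ)) ≤ 3 * ((D * n : ℕ) : ℝ) / m := by gcongr
      _ = 3 * D / x := by rw [hmx]; push_cast; field_simp
  calc (n.choose m : ℝ) * ((D * n).choose (m + r)) * ((m : ℝ) ^ 2) ^ (m + r)
      ≤ (3 / x) ^ m * (3 * D / x) ^ (m + r) * ((m : ℝ) ^ 2) ^ (m + r) := by gcongr
    _ = 3 ^ (2 * m + r) * (D : ℝ) ^ (m + r) * x ^ r * ((n : ℝ) ^ 2) ^ (m + r) := by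
      rw [hmx]
      simp only [div_pow, mul_pow, ← pow_mul]
      field_simp
      ring
    _ ≤ 3 ^ (9 * r) * (D : ℝ) ^ (5 * r) * x ^ r * ((n : ℝ) ^ 2) ^ (m + r) := by
      gcongr <;> first | lia | norm_num
    _ = (3 ^ 9 * (D : ℝ) ^ 5 * x) ^ r * ((n : ℝ) ^ 2) ^ (m + r) := by
      simp only [mul_pow, ← pow_mul]
    _ ≤ (1 / 256) ^ r * ((n : ℝ) ^ 2) ^ (m + r) := by gcongr
    _ = (1 / 4) ^ (4 * r) * ((n : ℝ) ^ 2) ^ (m + r) := by rw [pow_mul]; norm_num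
    _ ≤ (1 / 4) ^ m * ((n : ℝ) ^ 2) ^ (m + r) := by
      gcongr ?_ * _
      exact pow_le_pow_of_le_one (by norm_num) (by norm_num) (by lia)

/-- By Cauchy–Schwarz at least `n ^ 2 / q` pairs are monochromatic. The diagonal is counted on both
sides, and its `n ≤ n ^ 2 / (2 * q)` elements cost half of this gain. -/
theorem card_bichromatic_le {n q : ℕ} (hq : 1 ≤ q) (hn : 2 * q ≤ n) (g : Fin n → Fin q) :
    (#{e : Fin n × Fin n | e.1 ≠ e.2 → g e.1 ≠ g e.2} : ℝ) ≤ (1 - 1 / (2 * q)) * (n : ℝ) ^ 2 := by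
  set P : Finset (Fin n × Fin n) := {e | e.1 ≠ e.2 → g e.1 ≠ g e.2} with hP
  set Q : Finset (Fin n × Fin n) := {e | g e.1 = g e.2} with hQ
  have hPQ : #P + #Q ≤ n ^ 2 + n := by
    have h1 : #(P ∪ Q) ≤ n ^ 2 := (card_le_univ _).trans (by simp [sq])
    have h2 : #(P ∩ Q) ≤ n := by
      refine (card_le_card (t := univ.image fun x : Fin n => (x, x)) ?_).trans
        (card_image_le.trans (by simp))
      rintro ⟨x, y⟩ h
      simp only [hP, hQ, mem_inter, mem_filter, mem_univ, true_and, mem_image] at h ⊢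
      by_contra hne
      exact h.1 (fun e => hne ⟨x, by rw [e]⟩) h.2
    have := card_union_add_card_inter P Q
    lia
  have hQcard : #Q = ∑ c, #{x | g x = c} ^ 2 := by
    rw [card_eq_sum_card_fiberwise (f := fun e => g e.1) (t := univ) (fun _ _ => by simp)]
    refine sum_congr rfl fun c _ => ?_
    rw [sq, ← card_product]
    congr 1
    ext ⟨x, y⟩
    simp only [hQ, mem_filter, mem_univ, true_and, mem_product]
    grind
  have hsum : ∑ c, #{x | g x = c} = n := by
    rw [← card_eq_sum_card_fiberwise (f := g) (fun _ _ => by simp)]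
    simp
  have hcs : n ^ 2 ≤ q * #Q := by
    have := sq_sum_le_card_mul_sum_sq (s := (univ : Finset (Fin q)))
      (f := fun c => #{x | g x = c})
    rwa [hsum, ← hQcard, card_univ, Fintype.card_fin] at this
  have hq' : (0 : ℝ) < q := by exact_mod_cast hq
  have hPQ' : (#P : ℝ) + #Q ≤ n ^ 2 + n := by exact_mod_cast hPQ
  have hcs' : (n : ℝ) ^ 2 / q ≤ #Q := by
    rw [div_le_iff₀' hq']; exact_mod_cast hcs
  have hn' : (n : ℝ) ≤ n ^ 2 / (2 * q) := by
    rw [le_div_iff₀ (by positivity), sq]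
    gcongr
    exact_mod_cast hn
  have : (n : ℝ) ^ 2 / q = n ^ 2 / (2 * q) + n ^ 2 / (2 * q) := by field_simp; norm_num
  have h3 : (1 - 1 / (2 * q)) * (n : ℝ) ^ 2 = n ^ 2 - n ^ 2 / (2 * q) := by ring
  rw [h3]
  linarith

theorem sum_Icc_one_div_four_pow_le (n : ℕ) : ∑ m ∈ Icc 1 n, (1 / 4 : ℝ) ^ m ≤ 1 / 3 := by
  have : ∑ m ∈ Icc 1 n, (1 / 4 : ℝ) ^ m = (1 - (1 / 4) ^ n) / 3 := by
    induction n with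
    | zero => simp
    | succ n ih => rw [sum_Icc_succ_top (by lia), ih]; ring
  rw [this]
  have : (0 : ℝ) ≤ (1 / 4) ^ n := by positivity
  linarith

theorem exists_isLocallySparse_not_colorable {q : ℕ} (hq : 1 ≤ q) :
    ∃ C : ℕ, 0 < C ∧ ∀ n : ℕ, 2 * q ≤ n → ∃ (M : ℕ) (f : Fin M → Fin n × Fin n),
      (∀ s, C * s ≤ n → IsLocallySparse f s) ∧
      ∀ g : Fin n → Fin q, ∃ i, (f i).1 ≠ (f i).2 ∧ g (f i).1 = g (f i).2 := by
  have hq' : (1 : ℝ) ≤ q := by exact_mod_cast hq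
  have hb0 : (0 : ℝ) ≤ 1 - 1 / (2 * q) := by
    rw [sub_nonneg, div_le_one (by positivity)]; linarith
  have hb1 : 1 - 1 / (2 * q : ℝ) < 1 := by
    have : (0 : ℝ) < 1 / (2 * q) := by positivity
    linarith
  obtain ⟨D₀, hD₀⟩ := exists_pow_lt_of_lt_one (show (0 : ℝ) < 1 / (4 * q) by positivity) hb1
  -- This `D` makes the decay in `D * n` edges beat the `q ^ n` colourings.
  obtain ⟨D, hD, hDq⟩ : ∃ D : ℕ, 1 ≤ D ∧ q * (1 - 1 / (2 * q : ℝ)) ^ D ≤ 1 / 4 := by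
    refine ⟨D₀ + 1, by lia, ?_⟩
    have : (1 - 1 / (2 * q : ℝ)) ^ (D₀ + 1) ≤ 1 / (4 * q) :=
      (pow_le_pow_of_le_one hb0 hb1.le (Nat.le_succ D₀)).trans hD₀.le
    calc q * (1 - 1 / (2 * q : ℝ)) ^ (D₀ + 1) ≤ q * (1 / (4 * q)) := by gcongr
      _ = 1 / 4 := by field_simp
  refine ⟨256 * 3 ^ 9 * D ^ 5, by positivity, fun n hn => ⟨D * n, ?_⟩⟩
  set C := 256 * 3 ^ 9 * D ^ 5 with hC
  by_contra! hbad
  set P : (Fin n → Fin q) → Finset (Fin n × Fin n) := fun g =>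
    {e | e.1 ≠ e.2 → g e.1 ≠ g e.2} with hP
  set t : ℕ → ℕ := fun m => m + (m + 3) / 4 with ht
  set B₁ : Finset (Fin (D * n) → Fin n × Fin n) :=
    univ.biUnion fun g => {f | ∀ i ∈ univ, f i ∈ P g} with hB₁
  set B₂ : Finset (Fin (D * n) → Fin n × Fin n) :=
    ((Icc 1 n).filter fun m => C * m ≤ n).biUnion fun m =>
      (powersetCard m univ ×ˢ powersetCard (t m) univ).biUnion fun AT =>
        {f | ∀ i ∈ AT.2, f i ∈ AT.1 ×ˢ AT.1} with hB₂
  have hcover : univ ⊆ B₁ ∪ B₂ := by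
    intro f _
    rw [mem_union]
    by_cases hf : ∀ s, C * s ≤ n → IsLocallySparse f s
    · left
      obtain ⟨g, hg⟩ := hbad f hf
      simp only [hB₁, hP, mem_biUnion, mem_filter, mem_univ, true_and]
      exact ⟨g, fun i _ => hg i⟩
    · right
      simp only [IsLocallySparse] at hf
      push Not at hf
      obtain ⟨s, hs, A, hA, hAs, hAe⟩ := hf
      -- A violating `A` spans at least `⌈5 * #A / 4⌉ = t #A` edges.
      obtain ⟨T, hT, hTcard⟩ := exists_subset_card_eq (s := edgesInside f A) (n := t #A)
        (by simp only [ht]; lia)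
      simp only [hB₂, mem_biUnion, mem_filter, mem_univ, true_and, mem_product,
        mem_powersetCard, subset_univ, mem_Icc]
      exact ⟨#A, ⟨⟨hA.card_pos, (card_le_univ A).trans (by simp)⟩,
        (Nat.mul_le_mul_left C hAs).trans hs⟩, (A, T), ⟨rfl, hTcard⟩,
        fun i hi => mem_edgesInside.1 (hT hi)⟩
  have hN : (0 : ℝ) < ((n : ℝ) ^ 2) ^ (D * n) := by
    have : (0 : ℝ) < n := by exact_mod_cast (show 0 < n by lia)
    positivity
  have hcard₁ : (#B₁ : ℝ) ≤ 1 / 4 * ((n : ℝ) ^ 2) ^ (D * n) := by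
    have hPg : ∀ g, (#{f : Fin (D * n) → Fin n × Fin n | ∀ i ∈ univ, f i ∈ P g} : ℝ) ≤
        ((1 - 1 / (2 * q)) * (n : ℝ) ^ 2) ^ (D * n) := by
      intro g
      rw [card_filter_forall_mem]
      simp only [card_univ, Fintype.card_fin, Nat.sub_self, pow_zero, mul_one, Nat.cast_pow]
      exact pow_le_pow_left₀ (by positivity) (card_bichromatic_le hq hn g) _
    calc (#B₁ : ℝ) ≤ ∑ g, (#{f : Fin (D * n) → Fin n × Fin n | ∀ i ∈ univ, f i ∈ P g} : ℝ) := by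
          exact_mod_cast card_biUnion_le
      _ ≤ ∑ _g : Fin n → Fin q, ((1 - 1 / (2 * q)) * (n : ℝ) ^ 2) ^ (D * n) :=
          sum_le_sum fun g _ => hPg g
      _ = (q * (1 - 1 / (2 * q : ℝ)) ^ D) ^ n * ((n : ℝ) ^ 2) ^ (D * n) := by
          simp only [sum_const, card_univ, Fintype.card_pi, Fintype.card_fin, prod_const,
            nsmul_eq_mul, Nat.cast_pow, mul_pow, ← pow_mul]
          ring
      _ ≤ (1 / 4) ^ n * ((n : ℝ) ^ 2) ^ (D * n) := by gcongr
      _ ≤ 1 / 4 * ((n : ℝ) ^ 2) ^ (D * n) := by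
          gcongr ?_ * _
          exact pow_le_of_le_one (by norm_num) (by norm_num) (by lia)
  have hcard₂ : (#B₂ : ℝ) ≤ 1 / 3 * ((n : ℝ) ^ 2) ^ (D * n) := by
    have hm : ∀ m ∈ (Icc 1 n).filter fun m => C * m ≤ n,
        (#((powersetCard m univ ×ˢ powersetCard (t m) univ).biUnion fun AT =>
          ({f | ∀ i ∈ AT.2, f i ∈ AT.1 ×ˢ AT.1} :
            Finset (Fin (D * n) → Fin n × Fin n))) : ℝ) ≤
          (1 / 4) ^ m * ((n : ℝ) ^ 2) ^ (D * n) := by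
      intro m hm
      simp only [mem_filter, mem_Icc] at hm
      have hle : (#((powersetCard m univ ×ˢ powersetCard (t m) univ).biUnion fun AT =>
          ({f | ∀ i ∈ AT.2, f i ∈ AT.1 ×ˢ AT.1} :
            Finset (Fin (D * n) → Fin n × Fin n)))) ≤
          n.choose m * (D * n).choose (t m) * ((m ^ 2) ^ t m * (n ^ 2) ^ (D * n - t m)) := by
        refine (card_biUnion_le_card_mul _ _ ((m ^ 2) ^ t m * (n ^ 2) ^ (D * n - t m)) ?_).trans
          (le_of_eq ?_)
        · rintro ⟨A, T⟩ hAT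
          simp only [mem_product, mem_powersetCard, subset_univ, true_and] at hAT
          rw [card_filter_forall_mem, card_product, hAT.1, hAT.2]
          simp [sq]
        · simp [card_product, card_powersetCard]
      by_cases htM : t m ≤ D * n
      · calc _ ≤ ((n.choose m * (D * n).choose (t m) *
              ((m ^ 2) ^ t m * (n ^ 2) ^ (D * n - t m)) : ℕ) : ℝ) := by exact_mod_cast hle
          _ = (n.choose m : ℝ) * (D * n).choose (t m) * ((m : ℝ) ^ 2) ^ t m *
              ((n : ℝ) ^ 2) ^ (D * n - t m) := by push_cast; ring
          _ ≤ (1 / 4) ^ m * ((n : ℝ) ^ 2) ^ t m * ((n : ℝ) ^ 2) ^ (D * n - t m) := by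
              gcongr ?_ * _
              exact choose_mul_choose_mul_pow_le hm.1.1 hD hm.2
          _ = (1 / 4) ^ m * ((n : ℝ) ^ 2) ^ (D * n) := by
              rw [mul_assoc, ← pow_add, Nat.add_sub_cancel' htM]
      · rw [Nat.choose_eq_zero_of_lt (not_le.1 htM), mul_zero, zero_mul, Nat.le_zero] at hle
        rw [hle, Nat.cast_zero]
        positivity
    calc (#B₂ : ℝ) ≤ ∑ m ∈ (Icc 1 n).filter (fun m => C * m ≤ n),
          (#((powersetCard m univ ×ˢ powersetCard (t m) univ).biUnion fun AT =>
            ({f | ∀ i ∈ AT.2, f i ∈ AT.1 ×ˢ AT.1} :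
              Finset (Fin (D * n) → Fin n × Fin n))) : ℝ) := by
          exact_mod_cast card_biUnion_le
      _ ≤ ∑ m ∈ (Icc 1 n).filter (fun m => C * m ≤ n),
          (1 / 4) ^ m * ((n : ℝ) ^ 2) ^ (D * n) := sum_le_sum hm
      _ ≤ ∑ m ∈ Icc 1 n, (1 / 4) ^ m * ((n : ℝ) ^ 2) ^ (D * n) :=
          sum_le_sum_of_subset_of_nonneg (filter_subset _ _) fun _ _ _ => by positivity
      _ ≤ 1 / 3 * ((n : ℝ) ^ 2) ^ (D * n) := by
          rw [← sum_mul]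
          gcongr
          exact sum_Icc_one_div_four_pow_le n
  have htotal : ((n : ℝ) ^ 2) ^ (D * n) ≤ #B₁ + #B₂ := by
    have := (card_le_card hcover).trans (card_union_le B₁ B₂)
    simp only [card_univ, Fintype.card_pi, Fintype.card_prod, Fintype.card_fin, prod_const,
      ← sq] at this
    exact_mod_cast this
  linarith

/-! ### The lower bound and the equivalence -/

open Filter Asymptotics FirstOrder in
theorem PCSP.not_solvableInSublinearWidth {p q : ℕ} (hp : 3 ≤ p) (hq : 1 ≤ q) :
    ¬ PCSP.SolvableInSublinearWidth Language.graph (PCSP.K p) (PCSP.K q) := by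
  rintro ⟨k, hk, hsolv⟩
  obtain ⟨C, hC, hex⟩ := exists_isLocallySparse_not_colorable hq
  -- The closure argument takes `s = 6 * k n` and needs sparsity up to `2 * s = 12 * k n`.
  have hC' : (0 : ℝ) < (12 * C : ℕ) := by exact_mod_cast (show 0 < 12 * C by lia)
  obtain ⟨n, hkn, hn⟩ := ((hk.bound (inv_pos.2 hC')).and (eventually_ge_atTop (2 * q))).exists
  have hkn' : 12 * C * k n ≤ n := by
    rw [Real.norm_natCast, Real.norm_natCast, ← div_eq_inv_mul, le_div_iff₀' hC'] at hkn
    exact_mod_cast hkn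
  obtain ⟨M, f, hsparse, hcol⟩ := hex n hn
  let : Language.graph.Structure (Fin n) := (underlyingGraph f).structure
  have hcons : PCSP.Consistent Language.graph (k n) (Fin n) (PCSP.K p) :=
    PCSP.consistent_of_isLocallySparse (s := 6 * k n) (hsparse _ (by linarith)) le_rfl hp
  have hhom := hsolv (Fin n) (by rwa [Nat.card_fin])
  rw [PCSP.nonempty_hom_iff] at hhom
  obtain ⟨g, hg⟩ := hhom
  obtain ⟨i, hne, heq⟩ := hcol g
  exact PCSP.K.relMap_adj.1 (hg (f i).1 (f i).2 ⟨hne, .inl ⟨i, rfl⟩⟩) heq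

theorem theorem6p1 (p q : ℕ) (hp : 1 ≤ p) (hpq : p ≤ q) :
    List.TFAE [
      PCSP.SolvableInWidth FirstOrder.Language.graph (PCSP.K p) (PCSP.K q) (fun _ => 3),
      PCSP.SolvableInBoundedWidth FirstOrder.Language.graph (PCSP.K p) (PCSP.K q),
      PCSP.SolvableInSublinearWidth FirstOrder.Language.graph (PCSP.K p) (PCSP.K q),
      p = 1 ∨ p = 2] := by
  tfae_have 1 → 2 := fun h => ⟨fun _ => 3, Asymptotics.isBigO_const_const _ one_ne_zero _, h⟩
  tfae_have 2 → 3 := by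
    rintro ⟨k, hk, h⟩
    exact ⟨k, hk.trans_isLittleO
      ((Asymptotics.isLittleO_const_left.2 (.inr
        (tendsto_norm_atTop_atTop.comp tendsto_natCast_atTop_atTop)))), h⟩
  tfae_have 3 → 4 := by
    intro h
    by_contra hp'
    exact PCSP.not_solvableInSublinearWidth (by lia) (hp.trans hpq) h
  tfae_have 4 → 1 := by
    rintro (rfl | rfl)
    · exact PCSP.solvableInWidth_one hpq
    · exact PCSP.solvableInWidth_two hpq
  tfae_finish
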